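/- Theorem (Blocked random phase states are designs). Let $\xi\ge 1$, $m\ge 2$, $k\ge 0$ and $n=m\xi$, and divide $n$ qubits, arranged on a line with free ends or on a ring, into $m$ consecutive patches of $\xi$ qubits each. For every pair $(a,a+1)$ of consecutive patches ($1\le a\le m-1$; on the ring also the pair $(m,1)$) let $f_{a,a+1}:\{0,1\}^{2\xi}\to\{0,1\}$ be a random function. Suppose that these random functions are mutually independent, and that each of them is $2k$-wise independent: for all distinct $z_1,\dots,z_{2k}\in\{0,1\}^{2\xi}$ and all $y_1,\dots,y_{2k}\in\{0,1\}$, $\Pr[f_{a,a+1}(z_i)=y_i \text{ for all } i]=2^{-2k}$. For $x\in\{0,1\}^n$ let $x_{a,a+1}\in\{0,1\}^{2\xi}$ be the string of the bits of $x$ on the patches $a$ and $a+1$. Consider the blocked random binary phase state $$|\psi\rangle=\frac1{\sqrt{2^n}}\sum_{x\in\{0,1\}^n}(-1)^{\sum_a f_{a,a+1}(x_{a,a+1})}\,|x\rangle .$$ Then $|\psi\rangle$ is an approximate state $k$-design up to additive error $$\varepsilon=\frac{3nk^2}{2^{\xi}\,\xi}+\frac{2k^2}{2^n},$$ that is, for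 every unit vector $|\varphi\rangle\in(\mathbb C^2)^{\otimes n}$, $$\Big\|\,\mathbb E_{\psi}\big(|\psi\rangle\langle\psi|\big)^{\otimes k}-\mathbb E_{U}\,U^{\otimes k}\big(|\varphi\rangle\langle\varphi|\big)^{\otimes k}(U^\dagger)^{\otimes k}\Big\|_1\le\varepsilon ,$$ where $U$ is a Haar-random unitary on the $n$ qubits and $\|A\|_1=\operatorname{tr}\sqrt{A^\dagger A}$ is the trace norm. Moreover $\varepsilon\le 4nk^2/(2^{\xi}\xi)$, so that $\varepsilon=\mathcal O\big(nk^2/(2^{\xi}\xi)\big)$ with an absolute implied constant. -/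

import Mathlib

open MeasureTheory ProbabilityTheory

noncomputable section

/-- Bit strings of length `n`; they label the computational basis of `n` qubits. -/
abbrev Bits (n : ℕ) : Type := Fin n → Bool

/-- The trace norm `‖A‖₁ = tr √(Aᴴ A)`: the sum of the singular values of `A`. -/
def traceNorm {κ : Type*} [Fintype κ] [DecidableEq κ] (A : Matrix κ κ ℂ) : ℝ :=
  ∑ i, Real.sqrt ((Matrix.isHermitian_conjTranspose_mul_self A).eigenvalues i)

/-- The amplitudes of `|ψ⟩^{⊗ k}` in the product basis, which is labelled by lists
`x = (x 0, …, x (k - 1))` of basis labels. -/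
def tensorCopies {ι : Type*} (k : ℕ) (ψ : EuclideanSpace ℂ ι) : (Fin k → ι) → ℂ :=
  fun x => ∏ j, ψ (x j)

/-- The `k`-th moment `𝔼 (|ψ⟩⟨ψ|)^{⊗ k}` of a random state `ψ`, as a matrix in the product
basis (the expectation is taken entry by entry). -/
def stateMoment {ι Ω : Type*} [MeasurableSpace Ω] (k : ℕ) (μ : Measure Ω)
    (ψ : Ω → EuclideanSpace ℂ ι) : Matrix (Fin k → ι) (Fin k → ι) ℂ :=
  Matrix.of fun x y =>
    ∫ ω, Matrix.vecMulVec (tensorCopies k (ψ ω)) (star (tensorCopies k (ψ ω))) x y ∂μ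

section Haar

variable (ι : Type*) [Fintype ι] [DecidableEq ι]

instance unitaryGroupCompactSpace : CompactSpace (Matrix.unitaryGroup ι ℂ) := by
  refine (isCompact_iff_compactSpace
    (s := (Matrix.unitaryGroup ι ℂ : Set (Matrix ι ι ℂ)))).mp ?_
  have hK : IsCompact (Set.univ.pi fun _ : ι => Set.univ.pi fun _ : ι =>
      Metric.closedBall (0 : ℂ) 1) :=
    isCompact_univ_pi fun _ => isCompact_univ_pi fun _ => isCompact_closedBall _ _
  refine IsCompact.of_isClosed_subset hK (isClosed_unitary (R := Matrix ι ι ℂ)) ?_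
  intro U hU i _ j _
  simpa using entry_norm_bound_of_unitary (𝕜 := ℂ) hU i j

instance unitaryGroupMeasurableSpace : MeasurableSpace (Matrix.unitaryGroup ι ℂ) := borel _

instance unitaryGroupBorelSpace : BorelSpace (Matrix.unitaryGroup ι ℂ) := ⟨rfl⟩

/-- The Haar probability measure on the (compact) unitary group: the Haar measure that gives
the whole group mass one. -/
def haarUnitary : Measure (Matrix.unitaryGroup ι ℂ) := Measure.haarMeasure ⊤

end Haar

/-- The Haar twirl `𝔼_U U^{⊗ k} (|φ⟩⟨φ|)^{⊗ k} (Uᴴ)^{⊗ k}` of `k` copies of `φ`. -/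
def haarTwirl {ι : Type*} [Fintype ι] [DecidableEq ι] (k : ℕ) (φ : EuclideanSpace ℂ ι) :
    Matrix (Fin k → ι) (Fin k → ι) ℂ :=
  stateMoment k (haarUnitary ι) fun U => WithLp.toLp 2 ((U : Matrix ι ι ℂ).mulVec φ.ofLp)

/-- A random `n`-qubit state `ψ` is a state `k`-design up to additive error `ε`: its `k`-th
moment is `ε`-close, in trace norm, to the Haar twirl of `k` copies of any pure state. -/
def IsApproxStateDesign {n : ℕ} {Ω : Type*} [MeasurableSpace Ω] (k : ℕ) (μ : Measure Ω)
    (ψ : Ω → EuclideanSpace ℂ (Bits n)) (ε : ℝ) : Prop :=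
  ∀ φ : EuclideanSpace ℂ (Bits n), ‖φ‖ = 1 →
    traceNorm (stateMoment k μ ψ - haarTwirl k φ) ≤ ε

/-- A random binary function `f` is `t`-wise independent: at any `t` distinct inputs its values
are independent uniform bits. -/
def IsTWiseIndependent {Ω α : Type*} [MeasurableSpace Ω] (t : ℕ) (μ : Measure Ω)
    (f : Ω → α → Bool) : Prop :=
  ∀ x : Fin t → α, Function.Injective x → ∀ y : Fin t → Bool,
    μ.real {ω | ∀ i, f ω (x i) = y i} = (1 / 2 : ℝ) ^ t

/-- How the patches are arranged on a line: with free ends, or closed up to a ring. -/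
inductive Boundary where
  | free
  | periodic
  deriving DecidableEq

/-- Patch `c` comes directly after patch `a`, for `m` patches numbered `0, …, m - 1`. -/
def IsNextPatch (b : Boundary) {m : ℕ} (a c : Fin m) : Prop :=
  a.val + 1 = c.val ∨ (b = Boundary.periodic ∧ a.val + 1 = m ∧ c.val = 0)

instance (b : Boundary) {m : ℕ} (a c : Fin m) : Decidable (IsNextPatch b a c) :=
  inferInstanceAs (Decidable (_ ∨ _))

/-- The blocks of the brickwork: one for each pair of consecutive patches. The blocks whose first
patch has even number form one layer, the other ones the second layer; as all phase gates
commute, the order in which they are applied is immaterial. -/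
abbrev Block (b : Boundary) (m : ℕ) : Type :=
  {p : Fin m × Fin m // IsNextPatch b p.1 p.2}

/-- The `ξ` bits of `x` on patch `a`, that is, those at the positions `a ξ, …, a ξ + ξ - 1`. -/
def patchBits {n m ξ : ℕ} (hn : n = m * ξ) (x : Bits n) (a : Fin m) : Bits ξ :=
  fun i => x (Fin.cast hn.symm (finProdFinEquiv (a, i)))

/-- The `2 ξ` bits of `x` on the two patches of a block. -/
def blockBits {n m ξ : ℕ} (hn : n = m * ξ) {b : Boundary} (x : Bits n) (p : Block b m) :
    Bits (ξ + ξ) :=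
  Fin.append (patchBits hn x p.1.1) (patchBits hn x p.1.2)

/-- The blocked binary phase state
`2^{-n/2} ∑_x (-1)^{∑_p f_p(x_p)} |x⟩`, where `p` runs over the blocks. -/
def blockedPhaseState {n m ξ : ℕ} (hn : n = m * ξ) (b : Boundary)
    (f : Block b m → Bits (ξ + ξ) → Bool) : EuclideanSpace ℂ (Bits n) :=
  WithLp.toLp 2 fun x =>
    (1 / (Real.sqrt (2 ^ n) : ℂ)) * (-1) ^ ∑ p, (f p (blockBits hn x p)).toNat

end

section

open scoped ComplexOrder

open Matrix in
theorem traceNorm_eq_sum_abs_eigenvalues {κ : Type*} [Fintype κ] [DecidableEq κ]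
    {A : Matrix κ κ ℂ} (hA : A.IsHermitian) : traceNorm A = ∑ i, |hA.eigenvalues i| := by
  have hB := Matrix.isHermitian_conjTranspose_mul_self A
  have hchar : (Aᴴ * A).charpoly =
      ∏ i, (Polynomial.X - Polynomial.C (((hA.eigenvalues i) ^ 2 : ℝ) : ℂ)) := by
    have hU := hA.spectral_theorem
    set D : Matrix κ κ ℂ := diagonal (RCLike.ofReal ∘ hA.eigenvalues) with hD
    have hDD : D * D = diagonal (fun i => (((hA.eigenvalues i) ^ 2 : ℝ) : ℂ)) := by
      rw [hD, diagonal_mul_diagonal]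
      congr 1
      funext i
      simp [sq]
    have h1 : Aᴴ * A = Unitary.conjStarAlgAut ℂ _ hA.eigenvectorUnitary (D * D) := by
      rw [map_mul, ← hU, hA.eq]
    rw [h1, Unitary.conjStarAlgAut_apply, Matrix.charpoly_mul_comm, ← mul_assoc,
      Unitary.coe_star_mul_self, one_mul, hDD, charpoly_diagonal]
  have hmul : (Finset.univ.val.map fun i => ((hB.eigenvalues i : ℝ) : ℂ)) =
      Finset.univ.val.map fun i => (((hA.eigenvalues i) ^ 2 : ℝ) : ℂ) := by
    have h2 := hB.roots_charpoly_eq_eigenvalues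
    have h4 : (∏ i, (Polynomial.X - Polynomial.C (((hA.eigenvalues i) ^ 2 : ℝ) : ℂ))).roots =
        Finset.univ.val.map fun i => (((hA.eigenvalues i) ^ 2 : ℝ) : ℂ) := by
      rw [← Polynomial.roots_multiset_prod_X_sub_C (Finset.univ.val.map _), Multiset.map_map]
      rfl
    rw [hchar, h4] at h2
    exact h2.symm
  have h3 := congrArg (fun s : Multiset ℂ => (s.map fun z => Real.sqrt z.re).sum) hmul
  simp only [Multiset.map_map, Function.comp_def, Complex.ofReal_re, Real.sqrt_sq_eq_abs] at h3
  exact h3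

theorem Matrix.IsHermitian.sum_eigenvector_quadratic {κ : Type*} [Fintype κ] [DecidableEq κ]
    {A : Matrix κ κ ℂ} (hA : A.IsHermitian) (P : Matrix κ κ ℂ) :
    ∑ i, star (hA.eigenvectorBasis i).ofLp ⬝ᵥ P.mulVec (hA.eigenvectorBasis i).ofLp = P.trace := by
  have h : (star (hA.eigenvectorUnitary : Matrix κ κ ℂ) * P *
      (hA.eigenvectorUnitary : Matrix κ κ ℂ)).trace = P.trace := by
    rw [Matrix.trace_mul_comm, ← mul_assoc, Unitary.mul_star_self_of_mem (SetLike.coe_mem _),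
      one_mul]
  rw [← h, Matrix.trace]
  refine Finset.sum_congr rfl fun i _ => ?_
  rw [Matrix.diag_apply, mul_assoc, Matrix.mul_apply]
  simp [dotProduct, Matrix.mul_apply, Matrix.mulVec, Matrix.star_apply]

theorem traceNorm_sub_le {κ : Type*} [Fintype κ] [DecidableEq κ] {P R : Matrix κ κ ℂ}
    (hP : P.PosSemidef) (hR : R.PosSemidef) :
    traceNorm (P - R) ≤ P.trace.re + R.trace.re := by
  have hA : (P - R).IsHermitian := hP.1.sub hR.1
  rw [traceNorm_eq_sum_abs_eigenvalues hA, ← hA.sum_eigenvector_quadratic P,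
    ← hA.sum_eigenvector_quadratic R, Complex.re_sum, Complex.re_sum, ← Finset.sum_add_distrib]
  refine Finset.sum_le_sum fun i _ => ?_
  have h1 := hA.eigenvalues_eq i
  have h2 := hP.re_dotProduct_nonneg (hA.eigenvectorBasis i).ofLp
  have h3 := hR.re_dotProduct_nonneg (hA.eigenvectorBasis i).ofLp
  rw [Matrix.sub_mulVec, dotProduct_sub, map_sub] at h1
  simp only [RCLike.re_eq_complex_re] at h1 h2 h3
  rw [h1, abs_le]
  constructor <;> linarith

open Matrix in
/-- If `H` is `r` times `A` on a set `G` of indices, which `A` does not couple to its complement,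
then the two states are as close as the weight of `G` allows. -/
theorem traceNorm_sub_le_of_block {κ : Type*} [Fintype κ] [DecidableEq κ] {A H : Matrix κ κ ℂ}
    (hA : A.PosSemidef) (hH : H.PosSemidef) (hA1 : A.trace = 1) (hH1 : H.trace = 1)
    (G : Finset κ) (r s : ℝ) (hs1 : s ≤ 1) (hsr : s ≤ r)
    (hAG : ∀ x ∈ G, ∀ y ∉ G, A x y = 0) (hHG : ∀ x ∈ G, ∀ y, H x y = r * A x y) :
    traceNorm (A - H) ≤ 2 * (1 - s * ∑ x ∈ G, (A x x).re) := by
  set D : Matrix κ κ ℂ := diagonal fun x => if x ∈ G then 1 else 0 with hD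
  set E : Matrix κ κ ℂ := diagonal fun x => if x ∈ G then 0 else 1 with hE
  have hDH : Dᴴ = D := by
    rw [hD, diagonal_conjTranspose]
    congr 1
    ext x
    by_cases hx : x ∈ G <;> simp [hx]
  have hEH : Eᴴ = E := by
    rw [hE, diagonal_conjTranspose]
    congr 1
    ext x
    by_cases hx : x ∈ G <;> simp [hx]
  have hD1 : (D * A * D).PosSemidef := by
    have := hA.mul_mul_conjTranspose_same D
    rwa [hDH] at this
  have hE1 : (E * A * E).PosSemidef := by
    have := hA.mul_mul_conjTranspose_same E
    rwa [hEH] at this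
  have hE2 : (E * H * E).PosSemidef := by
    have := hH.mul_mul_conjTranspose_same E
    rwa [hEH] at this
  have hA' : ∀ x ∉ G, ∀ y ∈ G, A x y = 0 := fun x hx y hy => by
    rw [← hA.1.apply, hAG y hy x hx, star_zero]
  have hH' : ∀ x ∉ G, ∀ y ∈ G, H x y = 0 := fun x hx y hy => by
    rw [← hH.1.apply, hHG y hy x, hAG y hy x hx, mul_zero, star_zero]
  have eA : A - (s : ℂ) • (D * A * D) = ((1 - s : ℝ) : ℂ) • (D * A * D) + E * A * E := by
    ext x y
    by_cases hx : x ∈ G <;> by_cases hy : y ∈ G <;>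
      simp [hD, hE, hx, hy, hAG, hA', sub_mul, diagonal_mul, mul_diagonal]
  have eH : H - (s : ℂ) • (D * A * D) = ((r - s : ℝ) : ℂ) • (D * A * D) + E * H * E := by
    ext x y
    by_cases hx : x ∈ G <;> by_cases hy : y ∈ G <;>
      simp [hD, hE, hx, hy, hAG, hH', hHG, sub_mul, diagonal_mul, mul_diagonal]
  have pA : (A - (s : ℂ) • (D * A * D)).PosSemidef := by
    rw [eA]
    exact (hD1.smul (Complex.zero_le_real.mpr (sub_nonneg.mpr hs1))).add hE1
  have pH : (H - (s : ℂ) • (D * A * D)).PosSemidef := by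
    rw [eH]
    exact (hD1.smul (Complex.zero_le_real.mpr (sub_nonneg.mpr hsr))).add hE2
  have htr : (D * A * D).trace = ∑ x ∈ G, A x x := by
    simp [Matrix.trace, hD, diagonal_mul, mul_diagonal, ← ite_and]
  have key := traceNorm_sub_le pA pH
  rw [sub_sub_sub_cancel_right] at key
  refine key.trans (le_of_eq ?_)
  rw [trace_sub, trace_sub, trace_smul, htr, hA1, hH1]
  simp
  ring

/-- The trace distance of two states is at most two. -/
theorem traceNorm_sub_le_two {κ : Type*} [Fintype κ] [DecidableEq κ] {A H : Matrix κ κ ℂ}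
    (hA : A.PosSemidef) (hH : H.PosSemidef) (hA1 : A.trace = 1) (hH1 : H.trace = 1) :
    traceNorm (A - H) ≤ 2 := by
  have := traceNorm_sub_le hA hH
  rw [hA1, hH1, Complex.one_re] at this
  linarith

end

section

open scoped ComplexOrder

variable {ι Ω : Type*} [MeasurableSpace Ω] {k : ℕ} {μ : Measure Ω} {ψ : Ω → EuclideanSpace ℂ ι}

theorem stateMoment_apply (x y : Fin k → ι) :
    stateMoment k μ ψ x y =
      ∫ ω, tensorCopies k (ψ ω) x * star (tensorCopies k (ψ ω) y) ∂μ := rfl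

open Matrix in
theorem stateMoment_posSemidef [Fintype ι]
    (hint : ∀ x y, Integrable
      (fun ω => tensorCopies k (ψ ω) x * star (tensorCopies k (ψ ω) y)) μ) :
    (stateMoment k μ ψ).PosSemidef := by
  refine Matrix.PosSemidef.of_dotProduct_mulVec_nonneg ?_ fun v => ?_
  · ext x y
    rw [conjTranspose_apply, stateMoment_apply, stateMoment_apply, Complex.star_def,
      ← integral_conj]
    simp [mul_comm]
  · have h : star v ⬝ᵥ (stateMoment k μ ψ *ᵥ v) =
        ∫ ω, ((‖∑ x, star (v x) * tensorCopies k (ψ ω) x‖ ^ 2 : ℝ) : ℂ) ∂μ := by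
      have h1 : ∀ ω, ((‖∑ x, star (v x) * tensorCopies k (ψ ω) x‖ ^ 2 : ℝ) : ℂ) =
          ∑ x, ∑ y, star (v x) * v y *
            (tensorCopies k (ψ ω) x * star (tensorCopies k (ψ ω) y)) := fun ω => by
        rw [Complex.ofReal_pow, ← Complex.mul_conj', map_sum, Finset.sum_mul_sum]
        refine Finset.sum_congr rfl fun x _ => Finset.sum_congr rfl fun y _ => ?_
        simp
        ring
      simp_rw [h1]
      rw [integral_finsetSum _ fun x _ => integrable_finsetSum _ fun y _ =>
        (hint x y).const_mul _]
      simp_rw [dotProduct, mulVec, dotProduct, Finset.mul_sum]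
      refine Finset.sum_congr rfl fun x _ => ?_
      rw [integral_finsetSum _ fun y _ => (hint x y).const_mul _]
      refine Finset.sum_congr rfl fun y _ => ?_
      rw [integral_const_mul, stateMoment_apply, Pi.star_apply]
      ring
    rw [h, integral_complex_ofReal]
    exact Complex.zero_le_real.mpr (integral_nonneg fun ω => by positivity)

theorem tensorCopies_mul_star_self (φ : EuclideanSpace ℂ ι) (x : Fin k → ι) :
    tensorCopies k φ x * star (tensorCopies k φ x) = ((∏ j, ‖φ (x j)‖ ^ 2 : ℝ) : ℂ) := by
  rw [tensorCopies, Complex.star_def, Complex.mul_conj', norm_prod, ← Complex.ofReal_pow,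
    Finset.prod_pow]

theorem stateMoment_diag (x : Fin k → ι) :
    stateMoment k μ ψ x x = ((∫ ω, ∏ j, ‖ψ ω (x j)‖ ^ 2 ∂μ : ℝ) : ℂ) := by
  simp_rw [stateMoment_apply, tensorCopies_mul_star_self]
  exact integral_complex_ofReal

theorem stateMoment_trace [Fintype ι] [DecidableEq ι] [IsProbabilityMeasure μ]
    (hint : ∀ x : Fin k → ι, Integrable (fun ω => ∏ j, ‖ψ ω (x j)‖ ^ 2) μ)
    (hnorm : ∀ ω, ‖ψ ω‖ = 1) :
    (stateMoment k μ ψ).trace = 1 := by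
  rw [Matrix.trace]
  simp_rw [Matrix.diag_apply, stateMoment_diag]
  rw [← Complex.ofReal_sum, ← integral_finsetSum _ fun x _ => hint x]
  have h : ∀ ω, ∑ x : Fin k → ι, ∏ j, ‖ψ ω (x j)‖ ^ 2 = 1 := fun ω => by
    have := Finset.sum_pow' Finset.univ (fun z => ‖ψ ω z‖ ^ 2) k
    rw [Fintype.piFinset_univ] at this
    rw [← this, ← EuclideanSpace.norm_sq_eq, hnorm]
    simp
  simp_rw [h]
  simp

/-- The chance that two given entries of a sample of independent letters coincide. -/
theorem sum_prod_ite_eq [Fintype ι] [DecidableEq ι] (p : ι → ℝ) (hp : ∑ z, p z = 1)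
    {i j : Fin k} (hij : i ≠ j) :
    ∑ x : Fin k → ι, (if x i = x j then ∏ l, p (x l) else 0) = ∑ z, p z ^ 2 := by
  have h1 : ∀ x : Fin k → ι, (if x i = x j then ∏ l, p (x l) else 0) =
      ∑ z, ∏ l, (if l = i ∨ l = j then (if x l = z then p z else 0) else p (x l)) := by
    intro x
    split_ifs with h
    · rw [Finset.sum_eq_single (x i)]
      · refine Finset.prod_congr rfl fun l _ => ?_
        split_ifs with h1 h2
        · rw [h2]
        · rcases h1 with rfl | rfl
          · exact absurd rfl h2
          · exact absurd h.symm h2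
        · rfl
      · intro z _ hz
        exact Finset.prod_eq_zero (Finset.mem_univ i) (by simp [hz.symm])
      · simp
    · symm
      refine Finset.sum_eq_zero fun z _ => ?_
      by_cases hz : x i = z
      · exact Finset.prod_eq_zero (Finset.mem_univ j) (by simp [← hz, Ne.symm h])
      · exact Finset.prod_eq_zero (Finset.mem_univ i) (by simp [hz])
  simp_rw [h1]
  rw [Finset.sum_comm]
  refine Finset.sum_congr rfl fun z _ => ?_
  have h2 := (Finset.prod_univ_sum (fun _ : Fin k => (Finset.univ : Finset ι))
    (fun l t => if l = i ∨ l = j then (if t = z then p z else 0) else p t)).symm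
  rw [Fintype.piFinset_univ] at h2
  rw [h2]
  have h3 : ∀ l, ∑ t, (if l = i ∨ l = j then (if t = z then p z else 0) else p t) =
      if l ∈ ({i, j} : Finset (Fin k)) then p z else 1 := fun l => by
    by_cases hl : l = i ∨ l = j <;> simp [hl, hp]
  simp_rw [h3]
  rw [Finset.prod_ite_mem]
  simp [Finset.prod_pair hij, sq]

end

section

variable {ι : Type*} [Fintype ι] [DecidableEq ι]

instance isProbabilityMeasure_haarUnitary : IsProbabilityMeasure (haarUnitary ι) :=
  ⟨Measure.haarMeasure_self⟩

/-- The image of `φ` under a unitary matrix. -/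
noncomputable def applyUnitary (φ : EuclideanSpace ℂ ι) (U : Matrix.unitaryGroup ι ℂ) :
    EuclideanSpace ℂ ι :=
  WithLp.toLp 2 ((U : Matrix ι ι ℂ).mulVec φ.ofLp)

theorem haarTwirl_eq (k : ℕ) (φ : EuclideanSpace ℂ ι) :
    haarTwirl k φ = stateMoment k (haarUnitary ι) (applyUnitary φ) := rfl

theorem applyUnitary_apply (φ : EuclideanSpace ℂ ι) (U : Matrix.unitaryGroup ι ℂ) (z : ι) :
    applyUnitary φ U z = ∑ w, (U : Matrix ι ι ℂ) z w * φ w := rfl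

@[fun_prop]
theorem continuous_applyUnitary_apply (φ : EuclideanSpace ℂ ι) (z : ι) :
    Continuous fun U => applyUnitary φ U z := by
  simp_rw [applyUnitary_apply]
  refine continuous_finsetSum _ fun w _ => Continuous.mul ?_ continuous_const
  exact (continuous_apply_apply z w).comp continuous_subtype_val

theorem applyUnitary_mul (φ : EuclideanSpace ℂ ι) (V U : Matrix.unitaryGroup ι ℂ) :
    applyUnitary φ (V * U) = applyUnitary (applyUnitary φ U) V := by
  simp [applyUnitary, Matrix.mulVec_mulVec]

open Matrix in
theorem norm_applyUnitary (φ : EuclideanSpace ℂ ι) (U : Matrix.unitaryGroup ι ℂ) :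
    ‖applyUnitary φ U‖ = ‖φ‖ := by
  have h : ∀ φ : EuclideanSpace ℂ ι, ((‖φ‖ ^ 2 : ℝ) : ℂ) = star φ.ofLp ⬝ᵥ φ.ofLp := fun φ => by
    rw [EuclideanSpace.norm_sq_eq]
    simp [dotProduct, ← Complex.mul_conj', mul_comm]
  have h2 : ((‖applyUnitary φ U‖ ^ 2 : ℝ) : ℂ) = ((‖φ‖ ^ 2 : ℝ) : ℂ) := by
    rw [h, h, applyUnitary, star_mulVec, ← dotProduct_mulVec, mulVec_mulVec, ← star_eq_conjTranspose,
      Unitary.star_mul_self_of_mem U.2, one_mulVec]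
  exact (sq_eq_sq₀ (norm_nonneg _) (norm_nonneg _)).mp (Complex.ofReal_injective h2)

theorem Continuous.integrable_haarUnitary {E : Type*} [NormedAddCommGroup E]
    {g : Matrix.unitaryGroup ι ℂ → E} (hg : Continuous g) : Integrable g (haarUnitary ι) :=
  hg.integrable_of_hasCompactSupport (HasCompactSupport.of_compactSpace g)

instance isMulLeftInvariant_haarUnitary : (haarUnitary ι).IsMulLeftInvariant :=
  inferInstanceAs (Measure.haarMeasure _).IsMulLeftInvariant

theorem integral_applyUnitary_applyUnitary {E : Type*} [NormedAddCommGroup E] [NormedSpace ℝ E]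
    (φ : EuclideanSpace ℂ ι) (F : EuclideanSpace ℂ ι → E) (V : Matrix.unitaryGroup ι ℂ) :
    ∫ U, F (applyUnitary (applyUnitary φ U) V) ∂haarUnitary ι =
      ∫ U, F (applyUnitary φ U) ∂haarUnitary ι := by
  simp_rw [← applyUnitary_mul]
  exact integral_mul_left_eq_self (fun U => F (applyUnitary φ U)) V

open Matrix in
/-- Any unit vector is a row of a unitary matrix. -/
theorem exists_unitaryGroup_row (v : EuclideanSpace ℂ ι) (hv : ‖v‖ = 1) (i : ι) :
    ∃ V : Matrix.unitaryGroup ι ℂ, ∀ w, (V : Matrix ι ι ℂ) i w = v w := by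
  obtain ⟨b, hb⟩ := Orthonormal.exists_orthonormalBasis_extension_of_card_eq (𝕜 := ℂ)
    (finrank_euclideanSpace (𝕜 := ℂ) (ι := ι)) (v := fun _ => v) (s := {i})
    ⟨fun _ => hv, fun a c hac => absurd (Subsingleton.elim a c) hac⟩
  refine ⟨⟨Matrix.of fun i w => b i w, ?_⟩, fun w => ?_⟩
  · rw [Matrix.mem_unitaryGroup_iff]
    ext j l
    have h := orthonormal_iff_ite.mp b.orthonormal l j
    rw [PiLp.inner_apply] at h
    rw [Matrix.mul_apply, Matrix.one_apply]
    simp only [eq_comm (a := l)] at h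
    rw [← h]
    simp
  · simp [hb i rfl]

/-- The fourth moment of an overlap with a Haar-random state is the same for all unit vectors. -/
theorem integral_norm_overlap_pow (φ v : EuclideanSpace ℂ ι) (hv : ‖v‖ = 1) (i : ι) (t : ℕ) :
    ∫ U, ‖∑ w, v w * applyUnitary φ U w‖ ^ t ∂haarUnitary ι =
      ∫ U, ‖applyUnitary φ U i‖ ^ t ∂haarUnitary ι := by
  obtain ⟨V, hV⟩ := exists_unitaryGroup_row v hv i
  rw [← integral_applyUnitary_applyUnitary φ (fun ψ => ‖ψ i‖ ^ t) V]
  simp_rw [applyUnitary_apply (applyUnitary φ _), hV]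

theorem integral_norm_apply_pow (φ : EuclideanSpace ℂ ι) (z i : ι) (t : ℕ) :
    ∫ U, ‖applyUnitary φ U z‖ ^ t ∂haarUnitary ι =
      ∫ U, ‖applyUnitary φ U i‖ ^ t ∂haarUnitary ι := by
  rw [← integral_norm_overlap_pow φ (EuclideanSpace.single z 1) (by simp) i]
  simp

theorem integral_norm_add_pow_four (φ : EuclideanSpace ℂ ι) {i j : ι} (hij : i ≠ j) (u : ℂ)
    (hu : ‖u‖ = 1) :
    ∫ U, ‖applyUnitary φ U i + u * applyUnitary φ U j‖ ^ 4 ∂haarUnitary ι =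
      4 * ∫ U, ‖applyUnitary φ U i‖ ^ 4 ∂haarUnitary ι := by
  set v : EuclideanSpace ℂ ι := (1 / (Real.sqrt 2 : ℂ)) •
    (EuclideanSpace.single i 1 + u • EuclideanSpace.single j 1) with hv
  have h2 : (Real.sqrt 2) ^ 2 = 2 := Real.sq_sqrt zero_le_two
  have h4 : (Real.sqrt 2) ^ 4 = 4 := by rw [show 4 = 2 * 2 by rfl, pow_mul, h2]; norm_num
  have hn : ‖v‖ = 1 := by
    have h0 : ‖EuclideanSpace.single i (1 : ℂ) + u • EuclideanSpace.single j 1‖ ^ 2 = 2 := by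
      rw [@norm_add_sq ℂ]
      simp [norm_smul, hu, inner_smul_right, EuclideanSpace.inner_single_left, hij]
      norm_num
    rw [hv, norm_smul, ← sq_eq_sq₀ (by positivity) zero_le_one, mul_pow, h0]
    simp
  have key := integral_norm_overlap_pow φ v hn i 4
  have h5 : ∀ U, ‖∑ w, v w * applyUnitary φ U w‖ ^ 4 =
      1 / 4 * ‖applyUnitary φ U i + u * applyUnitary φ U j‖ ^ 4 := fun U => by
    have : ∑ w, v w * applyUnitary φ U w =
        1 / (Real.sqrt 2 : ℂ) * (applyUnitary φ U i + u * applyUnitary φ U j) := by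
      simp [hv, mul_assoc, add_mul, mul_add, Finset.sum_add_distrib]
    rw [this, norm_mul, mul_pow]
    congr 1
    simp [abs_of_nonneg (Real.sqrt_nonneg 2), h4]
  simp_rw [h5] at key
  rw [integral_const_mul] at key
  linarith

theorem norm_add_pow_four_average (a b : ℂ) :
    ∑ t : Fin 4, ‖a + ![1, -1, Complex.I, -Complex.I] t * b‖ ^ 4 =
      4 * ‖a‖ ^ 4 + 4 * ‖b‖ ^ 4 + 16 * (‖a‖ ^ 2 * ‖b‖ ^ 2) := by
  have h : ∀ z : ℂ, ‖z‖ ^ 4 = (‖z‖ ^ 2) ^ 2 := fun z => by ring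
  rw [Fin.sum_univ_four]
  simp only [h, Complex.sq_norm, Complex.normSq_apply]
  simp
  ring

theorem integral_sq_norm_mul_sq_norm (φ : EuclideanSpace ℂ ι) {i j : ι} (hij : i ≠ j) :
    2 * ∫ U, ‖applyUnitary φ U i‖ ^ 2 * ‖applyUnitary φ U j‖ ^ 2 ∂haarUnitary ι =
      ∫ U, ‖applyUnitary φ U i‖ ^ 4 ∂haarUnitary ι := by
  have hi : ∀ i, Integrable (fun U => 4 * ‖applyUnitary φ U i‖ ^ 4) (haarUnitary ι) := fun i =>
    Continuous.integrable_haarUnitary (by fun_prop)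
  have hij' : Integrable (fun U => 4 * ‖applyUnitary φ U i‖ ^ 4 + 4 * ‖applyUnitary φ U j‖ ^ 4)
    (haarUnitary ι) := Continuous.integrable_haarUnitary (by fun_prop)
  have hm : Integrable (fun U => 16 * (‖applyUnitary φ U i‖ ^ 2 * ‖applyUnitary φ U j‖ ^ 2))
    (haarUnitary ι) := Continuous.integrable_haarUnitary (by fun_prop)
  have h1 : ∫ U, ∑ t : Fin 4, ‖applyUnitary φ U i +
      ![1, -1, Complex.I, -Complex.I] t * applyUnitary φ U j‖ ^ 4 ∂haarUnitary ι =
      16 * ∫ U, ‖applyUnitary φ U i‖ ^ 4 ∂haarUnitary ι := by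
    rw [integral_finsetSum _ fun t _ => Continuous.integrable_haarUnitary (by fun_prop)]
    have h2 : ∀ t : Fin 4, ‖(![1, -1, Complex.I, -Complex.I] : Fin 4 → ℂ) t‖ = 1 := fun t => by
      fin_cases t <;> simp
    simp_rw [fun t => integral_norm_add_pow_four φ hij _ (h2 t)]
    simp
    ring
  simp_rw [norm_add_pow_four_average] at h1
  rw [integral_add hij' hm, integral_add (hi i) (hi j), integral_const_mul, integral_const_mul,
    integral_const_mul, integral_norm_apply_pow φ j i] at h1
  linarith

/-- The expected collision probability of the outcomes of a Haar-random state. -/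
theorem integral_sum_norm_pow_four (φ : EuclideanSpace ℂ ι) (hφ : ‖φ‖ = 1) :
    ∫ U, ∑ z, ‖applyUnitary φ U z‖ ^ 4 ∂haarUnitary ι = 2 / (Fintype.card ι + 1) := by
  have hne : Nonempty ι := by
    by_contra h
    rw [not_nonempty_iff] at h
    rw [Subsingleton.elim φ 0, norm_zero] at hφ
    exact zero_ne_one hφ
  obtain ⟨i⟩ := hne
  have hi : ∀ i, Integrable (fun U => ‖applyUnitary φ U i‖ ^ 4) (haarUnitary ι) := fun i =>
    Continuous.integrable_haarUnitary (by fun_prop)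
  have hm : ∀ i j, Integrable (fun U => ‖applyUnitary φ U i‖ ^ 2 * ‖applyUnitary φ U j‖ ^ 2)
    (haarUnitary ι) := fun i j => Continuous.integrable_haarUnitary (by fun_prop)
  set M := ∫ U, ‖applyUnitary φ U i‖ ^ 4 ∂haarUnitary ι with hM
  have h1 : ∫ U, ∑ z, ∑ w, ‖applyUnitary φ U z‖ ^ 2 * ‖applyUnitary φ U w‖ ^ 2 ∂haarUnitary ι
      = 1 := by
    simp_rw [← Finset.sum_mul_sum, ← EuclideanSpace.norm_sq_eq, norm_applyUnitary, hφ]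
    simp
  have h2 : ∀ z w, ∫ U, ‖applyUnitary φ U z‖ ^ 2 * ‖applyUnitary φ U w‖ ^ 2 ∂haarUnitary ι =
      M / 2 + if z = w then M / 2 else 0 := fun z w => by
    split_ifs with h
    · subst h
      rw [add_halves, hM, integral_norm_apply_pow φ i z]
      exact integral_congr_ae (.of_forall fun U => by ring)
    · have := integral_sq_norm_mul_sq_norm φ h
      rw [integral_norm_apply_pow φ z i] at this
      linarith
  rw [integral_finsetSum _ fun z _ => integrable_finsetSum _ fun w _ => hm z w] at h1
  simp_rw [integral_finsetSum _ fun w _ => hm _ w, h2, Finset.sum_add_distrib] at h1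
  simp at h1
  rw [integral_finsetSum _ fun z _ => hi z]
  simp_rw [fun z => integral_norm_apply_pow φ z i 4]
  rw [Finset.sum_const, Finset.card_univ, nsmul_eq_mul, ← hM, eq_div_iff (by positivity)]
  linarith

end

section

theorem tensorCopies_comp_perm {ι : Type*} {k : ℕ} (ψ : EuclideanSpace ℂ ι) (x : Fin k → ι)
    (σ : Equiv.Perm (Fin k)) : tensorCopies k ψ (x ∘ σ) = tensorCopies k ψ x :=
  Equiv.prod_comp σ fun j => ψ (x j)

theorem stateMoment_apply_comp_perm {k : ℕ} {ι Ω : Type*} [MeasurableSpace Ω] (μ : Measure Ω)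
    (ψ : Ω → EuclideanSpace ℂ ι) (x : Fin k → ι) (σ : Equiv.Perm (Fin k)) :
    stateMoment k μ ψ x (x ∘ σ) = stateMoment k μ ψ x x := by
  simp_rw [stateMoment_apply, tensorCopies_comp_perm]

theorem sum_filter_le_sum_sum_filter {κ τ : Type*} [Fintype κ] {w : κ → ℝ} (hw : ∀ x, 0 ≤ w x)
    (P : κ → Prop) [DecidablePred P] (T : Finset τ) (q : τ → κ → Prop)
    [∀ p, DecidablePred (q p)] (h : ∀ x, P x → ∃ p ∈ T, q p x) :
    ∑ x with P x, w x ≤ ∑ p ∈ T, ∑ x with q p x, w x := by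
  simp_rw [Finset.sum_filter]
  rw [Finset.sum_comm]
  refine Finset.sum_le_sum fun x _ => ?_
  have hn : ∀ p ∈ T, 0 ≤ if q p x then w x else 0 := fun p _ => by
    split_ifs
    exacts [hw x, le_rfl]
  split_ifs with hP
  · obtain ⟨p, hp, hq⟩ := h x hP
    exact (if_pos hq).symm.le.trans
      (Finset.single_le_sum (f := fun p => if q p x then w x else 0) hn hp)
  · exact Finset.sum_nonneg hn

variable {ι : Type*} [Fintype ι] [DecidableEq ι] {k : ℕ}

@[fun_prop]
theorem continuous_tensorCopies_applyUnitary (φ : EuclideanSpace ℂ ι) (x : Fin k → ι) :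
    Continuous fun U => tensorCopies k (applyUnitary φ U) x := by
  unfold tensorCopies
  fun_prop

open scoped ComplexOrder in
theorem haarTwirl_posSemidef (φ : EuclideanSpace ℂ ι) : (haarTwirl k φ).PosSemidef :=
  stateMoment_posSemidef fun _ _ => Continuous.integrable_haarUnitary (by fun_prop)

theorem haarTwirl_trace (φ : EuclideanSpace ℂ ι) (hφ : ‖φ‖ = 1) : (haarTwirl k φ).trace = 1 :=
  stateMoment_trace (fun _ => Continuous.integrable_haarUnitary (by fun_prop)) fun U => by
    rw [← hφ]
    exact norm_applyUnitary φ U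

theorem haarTwirl_apply (φ : EuclideanSpace ℂ ι) (x y : Fin k → ι) :
    haarTwirl k φ x y = ∫ U, tensorCopies k (applyUnitary φ U) x *
      star (tensorCopies k (applyUnitary φ U) y) ∂haarUnitary ι := rfl

theorem haarTwirl_apply_eq (φ : EuclideanSpace ℂ ι) (V : Matrix.unitaryGroup ι ℂ)
    (x y : Fin k → ι) :
    haarTwirl k φ x y = ∫ U, tensorCopies k (applyUnitary (applyUnitary φ U) V) x *
      star (tensorCopies k (applyUnitary (applyUnitary φ U) V) y) ∂haarUnitary ι :=
  (integral_applyUnitary_applyUnitary φ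
    (fun ψ => tensorCopies k ψ x * star (tensorCopies k ψ y)) V).symm

theorem haarTwirl_apply_eq_zero (φ : EuclideanSpace ℂ ι) {x y : Fin k → ι}
    (hx : Function.Injective x) {j : Fin k} (hj : ∀ i, y i ≠ x j) : haarTwirl k φ x y = 0 := by
  set d : ι → ℂ := fun w => if w = x j then -1 else 1 with hd
  have hV : Matrix.diagonal d ∈ Matrix.unitaryGroup ι ℂ := by
    rw [Matrix.mem_unitaryGroup_iff, Matrix.star_eq_conjTranspose, Matrix.diagonal_conjTranspose,
      Matrix.diagonal_mul_diagonal, ← Matrix.diagonal_one]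
    congr 1
    funext w
    by_cases hw : w = x j <;> simp [hd, hw]
  have ht : ∀ (ψ : EuclideanSpace ℂ ι) (t : Fin k → ι),
      tensorCopies k (applyUnitary ψ ⟨Matrix.diagonal d, hV⟩) t =
        (∏ i, d (t i)) * tensorCopies k ψ t := fun ψ t => by
    rw [tensorCopies, tensorCopies, ← Finset.prod_mul_distrib]
    refine Finset.prod_congr rfl fun i _ => ?_
    simp [applyUnitary, Matrix.mulVec_diagonal]
  have hdx : ∏ i, d (x i) = -1 := by
    simp [hd, hx.eq_iff, Finset.prod_ite_eq']
  have hdy : ∏ i, d (y i) = 1 := by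
    simp [hd, hj]
  have h := haarTwirl_apply_eq φ ⟨Matrix.diagonal d, hV⟩ x y
  simp_rw [ht, hdx, hdy] at h
  have h2 : haarTwirl k φ x y = -haarTwirl k φ x y := by
    conv_lhs => rw [h]
    rw [haarTwirl_apply, ← integral_neg]
    simp
  exact self_eq_neg.mp h2

theorem exists_perm_comp_eq {x y : Fin k → ι} (hx : Function.Injective x)
    (hy : Function.Injective y) : ∃ π : Equiv.Perm ι, ∀ j, π (x j) = y j := by
  let e : {w // w ∈ Set.range x} ≃ {w // w ∈ Set.range y} :=
    (Equiv.ofInjective x hx).symm.trans (Equiv.ofInjective y hy)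
  refine ⟨e.extendSubtype, fun j => ?_⟩
  rw [Equiv.extendSubtype_apply_of_mem e (x j) ⟨j, rfl⟩]
  have : (⟨x j, ⟨j, rfl⟩⟩ : {w // w ∈ Set.range x}) = Equiv.ofInjective x hx j := rfl
  rw [this]
  simp [e]

theorem haarTwirl_diag_eq (φ : EuclideanSpace ℂ ι) {x y : Fin k → ι}
    (hx : Function.Injective x) (hy : Function.Injective y) :
    haarTwirl k φ x x = haarTwirl k φ y y := by
  obtain ⟨π, hπ⟩ := exists_perm_comp_eq hx hy
  have hV : (Matrix.of fun z w => if π z = w then (1 : ℂ) else 0) ∈ Matrix.unitaryGroup ι ℂ := by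
    rw [Matrix.mem_unitaryGroup_iff]
    ext z w
    simp [Matrix.mul_apply, Matrix.one_apply, Matrix.star_apply, eq_comm]
  have ht : ∀ ψ : EuclideanSpace ℂ ι,
      tensorCopies k (applyUnitary ψ ⟨_, hV⟩) x = tensorCopies k ψ y := fun ψ => by
    rw [tensorCopies, tensorCopies]
    refine Finset.prod_congr rfl fun i _ => ?_
    simp [applyUnitary_apply, hπ]
  rw [haarTwirl_apply_eq φ ⟨_, hV⟩ x x]
  simp_rw [ht]
  rfl

theorem haarTwirl_diag_re_nonneg (φ : EuclideanSpace ℂ ι) (x : Fin k → ι) :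
    0 ≤ (haarTwirl k φ x x).re := by
  rw [haarTwirl_eq, stateMoment_diag, Complex.ofReal_re]
  exact integral_nonneg fun U => by positivity

theorem sum_haarTwirl_diag_re (φ : EuclideanSpace ℂ ι) (hφ : ‖φ‖ = 1) :
    ∑ x, (haarTwirl k φ x x).re = 1 := by
  have := congrArg Complex.re (haarTwirl_trace (k := k) φ hφ)
  rwa [Matrix.trace, Complex.re_sum] at this

/-- A Haar-random state is unlikely to give the same outcome twice in two given copies. -/
theorem sum_haarTwirl_collision (φ : EuclideanSpace ℂ ι) (hφ : ‖φ‖ = 1) {i j : Fin k}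
    (hij : i ≠ j) :
    ∑ x with x i = x j, (haarTwirl k φ x x).re = 2 / (Fintype.card ι + 1) := by
  rw [← integral_sum_norm_pow_four φ hφ, Finset.sum_filter]
  have h1 : ∀ U, ∑ z, ‖applyUnitary φ U z‖ ^ 4 = ∑ x : Fin k → ι,
      if x i = x j then ∏ l, ‖applyUnitary φ U (x l)‖ ^ 2 else 0 := fun U => by
    rw [sum_prod_ite_eq (fun z => ‖applyUnitary φ U z‖ ^ 2) _ hij]
    · exact Finset.sum_congr rfl fun z _ => by ring
    · rw [← EuclideanSpace.norm_sq_eq, norm_applyUnitary, hφ, one_pow]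
  simp_rw [h1]
  rw [integral_finsetSum]
  · refine Finset.sum_congr rfl fun x _ => ?_
    split_ifs
    · rw [haarTwirl_eq, stateMoment_diag, Complex.ofReal_re]
    · simp
  · intro x _
    split_ifs
    · exact Continuous.integrable_haarUnitary (by fun_prop)
    · exact integrable_zero _ _ _

theorem sum_haarTwirl_injective_ge (φ : EuclideanSpace ℂ ι) (hφ : ‖φ‖ = 1) :
    1 - (k : ℝ) ^ 2 * (2 / (Fintype.card ι + 1)) ≤
      ∑ x : Fin k → ι with Function.Injective x, (haarTwirl k φ x x).re := by
  have h1 := Finset.sum_filter_add_sum_filter_not Finset.univ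
    (fun x : Fin k → ι => Function.Injective x) fun x => (haarTwirl k φ x x).re
  rw [sum_haarTwirl_diag_re φ hφ] at h1
  have h2 : ∑ x : Fin k → ι with ¬Function.Injective x, (haarTwirl k φ x x).re ≤
      ∑ p : Fin k × Fin k with p.1 ≠ p.2, ∑ x : Fin k → ι with x p.1 = x p.2,
        (haarTwirl k φ x x).re := by
    refine sum_filter_le_sum_sum_filter (w := fun x => (haarTwirl k φ x x).re)
      (fun x => haarTwirl_diag_re_nonneg φ x) (fun x => ¬Function.Injective x) _
      (fun (p : Fin k × Fin k) (x : Fin k → ι) => x p.1 = x p.2) fun x hx => ?_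
    obtain ⟨i, j, h, hij⟩ := Function.not_injective_iff.mp hx
    exact ⟨(i, j), by simpa using hij, h⟩
  have h3 : ∑ p : Fin k × Fin k with p.1 ≠ p.2, ∑ x : Fin k → ι with x p.1 = x p.2,
        (haarTwirl k φ x x).re ≤ (k : ℝ) ^ 2 * (2 / (Fintype.card ι + 1)) := by
    rw [Finset.sum_congr rfl fun p hp =>
      sum_haarTwirl_collision φ hφ (Finset.mem_filter.mp hp).2, Finset.sum_const, nsmul_eq_mul]
    gcongr
    have := Finset.card_filter_le (Finset.univ : Finset (Fin k × Fin k)) fun p => p.1 ≠ p.2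
    rw [Finset.card_univ, Fintype.card_prod, Fintype.card_fin] at this
    rw [sq]
    exact_mod_cast this
  linarith

end

section

theorem Measurable.integrable_comp_of_finite {Ω D E : Type*} [MeasurableSpace Ω]
    [MeasurableSpace D] [Finite D] [DiscreteMeasurableSpace D] [NormedAddCommGroup E]
    {μ : Measure Ω} [IsFiniteMeasure μ] {X : Ω → D} (hX : Measurable X) (h : D → E) :
    Integrable (fun ω => h (X ω)) μ :=
  (Integrable.of_finite (μ := μ.map X) (f := h)).comp_measurable hX

/-- A function of at most `t` values of a `t`-wise independent random function averages out if
it changes sign with one of these values. -/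
theorem IsTWiseIndependent.integral_eq_zero {Ω α : Type*} [MeasurableSpace Ω] [Fintype α]
    [DecidableEq α] {t : ℕ} {μ : Measure Ω} [IsProbabilityMeasure μ] {f : Ω → α → Bool}
    (hf : IsTWiseIndependent t μ f) (hfm : Measurable f) (ht : t ≤ Fintype.card α)
    {S : Finset α} (hS : S.card ≤ t) {z : α} (hz : z ∈ S) (F : (α → Bool) → ℂ)
    (hF : ∀ g g', (∀ a ∈ S, g a = g' a) → F g = F g')
    (hodd : ∀ g, F (Function.update g z (!g z)) = -F g) :
    ∫ ω, F (f ω) ∂μ = 0 := by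
  obtain ⟨T, hST, hT⟩ := Finset.exists_superset_card_eq hS ht
  let e : Fin t ≃ T := (T.equivFinOfCardEq hT).symm
  let x : Fin t → α := fun i => e i
  have hx : Function.Injective x := Subtype.val_injective.comp e.injective
  have hxs : ∀ a ∈ S, ∃ i, x i = a := fun a ha =>
    ⟨e.symm ⟨a, hST ha⟩, by simp [x]⟩
  let ext : (Fin t → Bool) → α → Bool := fun y => Function.extend x y fun _ => false
  have hext : ∀ y i, ext y (x i) = y i := fun y i => hx.extend_apply _ _ _
  have h1 : ∀ ω, F (f ω) = F (ext (fun i => f ω (x i))) := fun ω => by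
    refine hF _ _ fun a ha => ?_
    obtain ⟨i, rfl⟩ := hxs a ha
    rw [hext]
  have hm : Measurable fun ω => (fun i => f ω (x i)) :=
    measurable_pi_lambda _ fun i => (measurable_pi_apply (x i)).comp hfm
  obtain ⟨i, hi⟩ := hxs z hz
  have hflip : ∀ y, F (ext (Function.update y i (!y i))) = -F (ext y) := fun y => by
    rw [← hodd]
    refine hF _ _ fun a ha => ?_
    obtain ⟨l, rfl⟩ := hxs a ha
    rw [hext, ← hi, hext]
    by_cases hl : l = i
    · subst hl
      simp
    · rw [Function.update_of_ne hl, Function.update_of_ne (hx.ne hl), hext]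
  have hsum : ∑ y, F (ext y) = 0 := by
    have hinv : Function.Involutive fun y : Fin t → Bool => Function.update y i (!y i) :=
      fun y => by simp
    have h2 := Equiv.sum_comp hinv.toPerm fun y => F (ext y)
    simp only [Function.Involutive.coe_toPerm, hflip, Finset.sum_neg_distrib] at h2
    exact self_eq_neg.mp h2.symm
  simp_rw [h1]
  rw [← integral_map (φ := fun ω => (fun i => f ω (x i))) (f := fun y => F (ext y))
    hm.aemeasurable (Measurable.of_discrete).aestronglyMeasurable,
    integral_fintype Integrable.of_finite]
  have h3 : ∀ y, (μ.map fun ω => (fun i => f ω (x i))).real {y} = (1 / 2 : ℝ) ^ t := fun y => by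
    rw [← hf x hx y, map_measureReal_apply hm (measurableSet_singleton y)]
    congr 1
    ext ω
    simp [funext_iff]
  simp_rw [h3]
  rw [← Finset.smul_sum, hsum, smul_zero]

/-- The sign by which the phase function `g` enters at the inputs `x`. -/
def phaseSign {α : Type*} {k : ℕ} (g : α → Bool) (x : Fin k → α) : ℂ :=
  ∏ j, (-1) ^ (g (x j)).toNat

theorem phaseSign_update_of_forall_ne {α : Type*} [DecidableEq α] {k : ℕ} (g : α → Bool)
    {y : Fin k → α} {z : α} (hy : ∀ i, y i ≠ z) (c : Bool) :
    phaseSign (Function.update g z c) y = phaseSign g y := by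
  simp [phaseSign, hy]

theorem phaseSign_update_not {α : Type*} [DecidableEq α] {k : ℕ} (g : α → Bool)
    {x : Fin k → α} (hx : Function.Injective x) (j : Fin k) :
    phaseSign (Function.update g (x j) (!g (x j))) x = -phaseSign g x := by
  rw [phaseSign, phaseSign, ← Finset.mul_prod_erase _ _ (Finset.mem_univ j),
    ← Finset.mul_prod_erase _ (fun j => (-1 : ℂ) ^ (g (x j)).toNat) (Finset.mem_univ j), ← neg_mul]
  congr 1
  · cases h : g (x j) <;> simp
  · refine Finset.prod_congr rfl fun i hi => ?_
    rw [Function.update_of_ne (hx.ne (Finset.ne_of_mem_erase hi))]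

theorem IsTWiseIndependent.integral_phaseSign_eq_zero {Ω α : Type*} [MeasurableSpace Ω]
    [Fintype α] [DecidableEq α] {k : ℕ} {μ : Measure Ω} [IsProbabilityMeasure μ]
    {f : Ω → α → Bool} (hf : IsTWiseIndependent (2 * k) μ f) (hfm : Measurable f)
    (hk : 2 * k ≤ Fintype.card α) {x y : Fin k → α} (hx : Function.Injective x) {j : Fin k}
    (hj : ∀ i, y i ≠ x j) :
    ∫ ω, phaseSign (f ω) x * phaseSign (f ω) y ∂μ = 0 := by
  refine hf.integral_eq_zero hfm hk (S := Finset.univ.image x ∪ Finset.univ.image y) ?_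
    (z := x j) (by simp) (fun g => phaseSign g x * phaseSign g y) ?_ ?_
  · refine (Finset.card_union_le _ _).trans ?_
    have h1 := Finset.card_image_le (s := Finset.univ) (f := x)
    have h2 := Finset.card_image_le (s := Finset.univ) (f := y)
    rw [Finset.card_univ, Fintype.card_fin] at h1 h2
    omega
  · intro g g' h
    have h1 : ∀ i, g (x i) = g' (x i) := fun i => h _ (by simp)
    have h2 : ∀ i, g (y i) = g' (y i) := fun i => h _ (by simp)
    simp [phaseSign, h1, h2]
  · intro g
    rw [phaseSign_update_not g hx, phaseSign_update_of_forall_ne g hj, neg_mul]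

variable {n m ξ k : ℕ} (hn : n = m * ξ) (b : Boundary)

theorem tensorCopies_blockedPhaseState (f : Block b m → Bits (ξ + ξ) → Bool)
    (x : Fin k → Bits n) :
    tensorCopies k (blockedPhaseState hn b f) x =
      (1 / (Real.sqrt (2 ^ n) : ℂ)) ^ k * ∏ p, phaseSign (f p) fun j => blockBits hn (x j) p := by
  simp only [tensorCopies, blockedPhaseState, phaseSign, Finset.prod_mul_distrib,
    Finset.prod_const, Finset.card_univ, Fintype.card_fin]
  rw [Finset.prod_comm]
  simp_rw [Finset.prod_pow_eq_pow_sum]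

theorem star_phaseSign {α : Type*} (g : α → Bool) (x : Fin k → α) :
    star (phaseSign g x) = phaseSign g x := by
  simp [phaseSign]

theorem tensorCopies_mul_star_blockedPhaseState (f : Block b m → Bits (ξ + ξ) → Bool)
    (x y : Fin k → Bits n) :
    tensorCopies k (blockedPhaseState hn b f) x *
        star (tensorCopies k (blockedPhaseState hn b f) y) =
      (1 / 2 ^ n) ^ k * ∏ p, (phaseSign (f p) (fun j => blockBits hn (x j) p) *
        phaseSign (f p) fun j => blockBits hn (y j) p) := by
  have h : (1 / (Real.sqrt (2 ^ n) : ℂ)) * (1 / (Real.sqrt (2 ^ n) : ℂ)) = 1 / 2 ^ n := by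
    rw [div_mul_div_comm, ← Complex.ofReal_mul, Real.mul_self_sqrt (by positivity)]
    simp
  have hs : star (1 / (Real.sqrt (2 ^ n) : ℂ)) = 1 / (Real.sqrt (2 ^ n) : ℂ) := by simp
  rw [tensorCopies_blockedPhaseState, tensorCopies_blockedPhaseState, star_mul', star_pow, hs,
    star_prod]
  simp_rw [star_phaseSign]
  rw [Finset.prod_mul_distrib, ← h, mul_pow]
  ring

theorem norm_sq_blockedPhaseState_apply (f : Block b m → Bits (ξ + ξ) → Bool) (x : Bits n) :
    ‖blockedPhaseState hn b f x‖ ^ 2 = 1 / 2 ^ n := by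
  simp only [blockedPhaseState, norm_mul, norm_pow, norm_div, norm_neg, norm_one, one_pow, mul_one,
    div_pow, Complex.norm_real, Real.norm_eq_abs, sq_abs]
  rw [Real.sq_sqrt (by positivity)]

theorem norm_blockedPhaseState (f : Block b m → Bits (ξ + ξ) → Bool) :
    ‖blockedPhaseState hn b f‖ = 1 := by
  rw [← sq_eq_sq₀ (norm_nonneg _) zero_le_one, EuclideanSpace.norm_sq_eq]
  simp_rw [norm_sq_blockedPhaseState_apply]
  simp

section Random

variable {Ω : Type*} [MeasurableSpace Ω] {μ : Measure Ω} [IsProbabilityMeasure μ]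
  {f : Block b m → Ω → Bits (ξ + ξ) → Bool}

open scoped ComplexOrder in
theorem phaseMoment_posSemidef (hf : ∀ p, Measurable (f p)) :
    (stateMoment k μ fun ω => blockedPhaseState hn b fun p => f p ω).PosSemidef :=
  stateMoment_posSemidef fun x y => (measurable_pi_lambda _ hf).integrable_comp_of_finite
    fun g => tensorCopies k (blockedPhaseState hn b g) x *
      star (tensorCopies k (blockedPhaseState hn b g) y)

theorem phaseMoment_trace (hf : ∀ p, Measurable (f p)) :
    (stateMoment k μ fun ω => blockedPhaseState hn b fun p => f p ω).trace = 1 :=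
  stateMoment_trace (fun x => (measurable_pi_lambda _ hf).integrable_comp_of_finite
    fun g => ∏ j, ‖blockedPhaseState hn b g (x j)‖ ^ 2) fun _ => norm_blockedPhaseState hn b _

theorem phaseMoment_diag (x : Fin k → Bits n) :
    stateMoment k μ (fun ω => blockedPhaseState hn b fun p => f p ω) x x =
      ((1 / 2 ^ n : ℝ) ^ k : ℝ) := by
  rw [stateMoment_diag]
  simp_rw [norm_sq_blockedPhaseState_apply]
  simp

theorem phaseMoment_apply_eq_zero (hf : ∀ p, Measurable (f p)) (hind : iIndepFun f μ)
    (hw : ∀ p, IsTWiseIndependent (2 * k) μ (f p)) (hk : 2 * k ≤ 2 ^ (ξ + ξ))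
    {x y : Fin k → Bits n} (p : Block b m)
    (hx : Function.Injective fun j => blockBits hn (x j) p) {j : Fin k}
    (hj : ∀ i, blockBits hn (y i) p ≠ blockBits hn (x j) p) :
    stateMoment k μ (fun ω => blockedPhaseState hn b fun p => f p ω) x y = 0 := by
  simp_rw [stateMoment_apply, tensorCopies_mul_star_blockedPhaseState]
  rw [integral_const_mul, hind.integral_fun_prod_comp
    (f := fun p g => phaseSign g (fun j => blockBits hn (x j) p) *
      phaseSign g fun j => blockBits hn (y j) p) (fun p => (hf p).aemeasurable)
    fun p => Measurable.of_discrete.aestronglyMeasurable,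
    Finset.prod_eq_zero (Finset.mem_univ p), mul_zero]
  exact (hw p).integral_phaseSign_eq_zero (hf p) (by simpa using hk) hx hj

end Random

/-- A bit string as the list of its patches. -/
def patchEquiv : Bits n ≃ (Fin m → Bits ξ) where
  toFun := patchBits hn
  invFun v i := v (finProdFinEquiv.symm (Fin.cast hn i)).1 (finProdFinEquiv.symm (Fin.cast hn i)).2
  left_inv x := by
    funext i
    simp only [patchBits, Prod.mk.eta, Equiv.apply_symm_apply]
    rfl
  right_inv v := by
    funext a i
    simp [patchBits]

theorem blockBits_eq_iff {x y : Bits n} (p : Block b m) :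
    blockBits hn x p = blockBits hn y p ↔
      patchBits hn x p.1.1 = patchBits hn y p.1.1 ∧ patchBits hn x p.1.2 = patchBits hn y p.1.2 := by
  refine ⟨fun h => ⟨funext fun i => ?_, funext fun i => ?_⟩, fun h => ?_⟩
  · have := congrFun h (Fin.castAdd ξ i)
    rwa [blockBits, blockBits, Fin.append_left, Fin.append_left] at this
  · have := congrFun h (Fin.natAdd ξ i)
    rwa [blockBits, blockBits, Fin.append_right, Fin.append_right] at this
  · rw [blockBits, blockBits, h.1, h.2]

/-- The bit strings of `x` differ pairwise on each patch. -/
def PatchwiseInjective (x : Fin k → Bits n) : Prop :=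
  ∀ a, Function.Injective fun j => patchBits hn (x j) a

variable {hn} in
theorem PatchwiseInjective.injective {x : Fin k → Bits n} (hx : PatchwiseInjective hn x)
    (hm : 0 < m) : Function.Injective x := fun i j h =>
  hx ⟨0, hm⟩ (by simp only [h])

variable {hn b} in
theorem PatchwiseInjective.exists_perm {x y : Fin k → Bits n} (hx : PatchwiseInjective hn x)
    (hm : 2 ≤ m)
    (h : ∀ (p : Block b m) (j : Fin k), ∃ i, blockBits hn (y i) p = blockBits hn (x j) p) :
    ∃ σ : Equiv.Perm (Fin k), y = x ∘ σ := by
  simp_rw [blockBits_eq_iff] at h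
  choose τ hτ using h
  let q : (a : ℕ) → a + 1 < m → Block b m := fun a ha =>
    ⟨(⟨a, by omega⟩, ⟨a + 1, ha⟩), Or.inl rfl⟩
  have hinj : ∀ p, Function.Injective (τ p) := fun p i j hij => by
    refine hx p.1.1 ?_
    simp only
    rw [← (hτ p i).1, ← (hτ p j).1, hij]
  have hsurj : ∀ p, Function.Surjective (τ p) := fun p => Finite.surjective_of_injective (hinj p)
  let p₀ := q 0 (by omega)
  have key : ∀ a (ha : a < m) j,
      patchBits hn (y (τ p₀ j)) ⟨a, ha⟩ = patchBits hn (x j) ⟨a, ha⟩ := by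
    intro a
    induction a with
    | zero => exact fun ha j => (hτ p₀ j).1
    | succ a ih =>
      intro ha j
      obtain ⟨l, hl⟩ := hsurj (q a ha) (τ p₀ j)
      have h1 := (hτ (q a ha) l).1
      rw [hl] at h1
      have h2 : l = j := hx ⟨a, by omega⟩ (h1.symm.trans (ih (by omega) j))
      subst h2
      rw [← hl]
      exact (hτ (q a ha) l).2
  refine ⟨(Equiv.ofBijective (τ p₀) ⟨hinj p₀, hsurj p₀⟩).symm, ?_⟩
  funext i
  obtain ⟨j, rfl⟩ := hsurj p₀ i
  have : (Equiv.ofBijective (τ p₀) ⟨hinj p₀, hsurj p₀⟩).symm (τ p₀ j) = j :=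
    (Equiv.ofBijective (τ p₀) ⟨hinj p₀, hsurj p₀⟩).symm_apply_apply j
  rw [Function.comp_apply, this]
  exact (patchEquiv hn).injective (funext fun a => key a a.2 j)

theorem card_patch_collision_mul (a : Fin m) {i j : Fin k} (hij : i ≠ j) :
    (Finset.univ.filter fun x : Fin k → Bits n =>
      patchBits hn (x i) a = patchBits hn (x j) a).card * 2 ^ ξ ≤ (2 ^ n) ^ k := by
  let g : {x : Fin k → Bits n // patchBits hn (x i) a = patchBits hn (x j) a} × Bits ξ →
      (Fin k → Bits n) := fun q => Function.update q.1.1 i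
    ((patchEquiv hn).symm (Function.update (patchEquiv hn (q.1.1 i)) a q.2))
  have hg : Function.Injective g := by
    rintro ⟨⟨x, hx⟩, v⟩ ⟨⟨y, hy⟩, w⟩ h
    have hne : ∀ l, l ≠ i → x l = y l := fun l hl => by
      have := congrFun h l
      simpa [g, hl] using this
    have hi : Function.update (patchEquiv hn (x i)) a v =
        Function.update (patchEquiv hn (y i)) a w := by
      have := congrFun h i
      simpa [g] using this
    have hv : v = w := by simpa using congrFun hi a
    have hxi : x i = y i := by
      refine (patchEquiv hn).injective (funext fun c => ?_)
      by_cases hc : c = a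
      · subst hc
        change patchBits hn (x i) c = patchBits hn (y i) c
        rw [hx, hy, hne j hij.symm]
      · simpa [hc] using congrFun hi c
    have hxy : x = y := funext fun l => by
      by_cases hl : l = i
      · rw [hl, hxi]
      · exact hne l hl
    subst hxy hv
    rfl
  have := Fintype.card_le_of_injective g hg
  simpa [Fintype.card_subtype] using this

end

section

open Classical in
theorem card_patchwiseInjective_ge {n m ξ k : ℕ} (hn : n = m * ξ) :
    1 - m * (k : ℝ) ^ 2 / 2 ^ ξ ≤
      (Finset.univ.filter fun x : Fin k → Bits n => PatchwiseInjective hn x).card *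
        (1 / 2 ^ n : ℝ) ^ k := by
  have hN : ∑ x : Fin k → Bits n, (1 / 2 ^ n : ℝ) ^ k = 1 := by simp
  rw [← Finset.sum_filter_add_sum_filter_not Finset.univ
    (fun x : Fin k → Bits n => PatchwiseInjective hn x), Finset.sum_const, nsmul_eq_mul] at hN
  have h1 : ∑ x : Fin k → Bits n with ¬PatchwiseInjective hn x, (1 / 2 ^ n : ℝ) ^ k ≤
      ∑ p : Fin m × Fin k × Fin k with p.2.1 ≠ p.2.2,
        ∑ x : Fin k → Bits n with patchBits hn (x p.2.1) p.1 = patchBits hn (x p.2.2) p.1,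
          (1 / 2 ^ n : ℝ) ^ k := by
    refine sum_filter_le_sum_sum_filter (w := fun _ => (1 / 2 ^ n : ℝ) ^ k)
      (fun x => by positivity) (fun x => ¬PatchwiseInjective hn x) _
      (fun (p : Fin m × Fin k × Fin k) (x : Fin k → Bits n) =>
        patchBits hn (x p.2.1) p.1 = patchBits hn (x p.2.2) p.1) fun x hx => ?_
    rw [PatchwiseInjective, not_forall] at hx
    obtain ⟨a, ha⟩ := hx
    obtain ⟨i, j, h, hij⟩ := Function.not_injective_iff.mp ha
    exact ⟨(a, i, j), by simpa using hij, h⟩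
  have h2 : ∀ p ∈ Finset.univ.filter fun p : Fin m × Fin k × Fin k => p.2.1 ≠ p.2.2,
      ∑ x : Fin k → Bits n with patchBits hn (x p.2.1) p.1 = patchBits hn (x p.2.2) p.1,
          (1 / 2 ^ n : ℝ) ^ k ≤ 1 / 2 ^ ξ := fun p hp => by
    have h3 := card_patch_collision_mul hn p.1 (Finset.mem_filter.mp hp).2
    rw [Finset.sum_const, nsmul_eq_mul, one_div_pow, mul_one_div, div_le_div_iff₀ (by positivity)
      (by positivity), one_mul]
    exact_mod_cast h3
  have h4 := Finset.sum_le_card_nsmul _ _ _ h2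
  have h5 : ((Finset.univ.filter fun p : Fin m × Fin k × Fin k => p.2.1 ≠ p.2.2).card : ℝ) ≤
      m * (k : ℝ) ^ 2 := by
    have := Finset.card_filter_le (Finset.univ : Finset (Fin m × Fin k × Fin k))
      fun p => p.2.1 ≠ p.2.2
    rw [Finset.card_univ, Fintype.card_prod, Fintype.card_prod, Fintype.card_fin,
      Fintype.card_fin] at this
    rw [sq]
    exact_mod_cast this
  rw [nsmul_eq_mul] at h4
  have h6 := mul_le_mul_of_nonneg_right h5 (by positivity : (0 : ℝ) ≤ 1 / 2 ^ ξ)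
  rw [mul_one_div] at h6 h4
  rw [mul_one_div] at h6
  linarith

/-- The distance of the blocked phase ensemble from the Haar ensemble, when the independence
of the phase functions is not vacuous. -/
theorem traceNorm_phaseMoment_sub_haarTwirl_le {n k ξ m : ℕ} (hm : 2 ≤ m) (hn : n = m * ξ)
    (b : Boundary) {Ω : Type*} [MeasurableSpace Ω] (μ : Measure Ω) [IsProbabilityMeasure μ]
    (f : Block b m → Ω → Bits (ξ + ξ) → Bool) (hf : ∀ p, Measurable (f p)) (hind : iIndepFun f μ)
    (hw : ∀ p, IsTWiseIndependent (2 * k) μ (f p)) (hk : 2 * k ≤ 2 ^ (ξ + ξ))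
    (φ : EuclideanSpace ℂ (Bits n)) (hφ : ‖φ‖ = 1) :
    traceNorm (stateMoment k μ (fun ω => blockedPhaseState hn b fun p => f p ω) - haarTwirl k φ) ≤
      2 * (k ^ 2 * (2 / (2 ^ n + 1))) + 2 * (m * k ^ 2 / 2 ^ ξ) := by
  classical
  set A := stateMoment k μ (fun ω => blockedPhaseState hn b fun p => f p ω) with hA
  have hcard : Fintype.card (Bits n) = 2 ^ n := by simp
  have hle : k ≤ Fintype.card (Bits n) := by
    have : 2 ^ (ξ + ξ) ≤ 2 ^ n := Nat.pow_le_pow_right two_pos (by rw [hn]; nlinarith)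
    omega
  obtain ⟨x₀⟩ : Nonempty (Fin k ↪ Bits n) :=
    Function.Embedding.nonempty_of_card_le (by simpa using hle)
  set c := (haarTwirl k φ x₀ x₀).re with hc
  have hcH : ∀ x, Function.Injective x → haarTwirl k φ x x = (c : ℂ) := fun x hx => by
    rw [hc, haarTwirl_diag_eq φ hx x₀.injective, haarTwirl_eq, stateMoment_diag, Complex.ofReal_re]
  set s := ∑ x : Fin k → Bits n with Function.Injective x, (haarTwirl k φ x x).re with hs
  have hs1 : s ≤ 1 := by
    rw [← sum_haarTwirl_diag_re (k := k) φ hφ]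
    exact Finset.sum_le_sum_of_subset_of_nonneg (Finset.filter_subset _ _)
      fun x _ _ => haarTwirl_diag_re_nonneg φ x
  have hs0 : 0 ≤ s := Finset.sum_nonneg fun x _ => haarTwirl_diag_re_nonneg φ x
  have hsr : s ≤ c * (2 ^ n) ^ k := by
    have h1 : s = (Finset.univ.filter fun x : Fin k → Bits n => Function.Injective x).card * c := by
      rw [hs, ← nsmul_eq_mul]
      refine Finset.sum_eq_card_nsmul fun x hx => ?_
      rw [hcH x (Finset.mem_filter.mp hx).2, Complex.ofReal_re]
    have h2 := Finset.card_filter_le (Finset.univ : Finset (Fin k → Bits n)) Function.Injective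
    rw [Finset.card_univ, Fintype.card_fun, hcard, Fintype.card_fin] at h2
    rw [h1, mul_comm]
    exact mul_le_mul_of_nonneg_left (by exact_mod_cast h2) (haarTwirl_diag_re_nonneg φ _)
  have hswge := sum_haarTwirl_injective_ge (k := k) φ hφ
  rw [hcard] at hswge
  have hdich : ∀ x, PatchwiseInjective hn x → ∀ y, (∃ σ : Equiv.Perm (Fin k), y = x ∘ σ) ∨
      (A x y = 0 ∧ haarTwirl k φ x y = 0) := by
    intro x hx y
    by_cases h : ∀ (p : Block b m) (j : Fin k), ∃ i, blockBits hn (y i) p = blockBits hn (x j) p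
    · exact Or.inl (hx.exists_perm hm h)
    · push Not at h
      obtain ⟨p, j, hj⟩ := h
      refine Or.inr ⟨phaseMoment_apply_eq_zero hn b hf hind hw hk p (fun i l hil => ?_) hj,
        haarTwirl_apply_eq_zero φ (hx.injective (by omega)) (j := j) fun i hi => hj i (by rw [hi])⟩
      exact hx p.1.1 ((blockBits_eq_iff hn b p).mp hil).1
  have key := traceNorm_sub_le_of_block (phaseMoment_posSemidef (μ := μ) hn b hf)
    (haarTwirl_posSemidef φ) (phaseMoment_trace (μ := μ) hn b hf) (haarTwirl_trace φ hφ)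
    (Finset.univ.filter fun x : Fin k → Bits n => PatchwiseInjective hn x) (c * (2 ^ n) ^ k) s hs1
    hsr ?_ ?_
  · have hG := card_patchwiseInjective_ge (k := k) hn
    have hsum : ∑ x : Fin k → Bits n with PatchwiseInjective hn x, (A x x).re =
        (Finset.univ.filter fun x : Fin k → Bits n => PatchwiseInjective hn x).card *
          (1 / 2 ^ n : ℝ) ^ k := by
      simp_rw [hA, phaseMoment_diag, Complex.ofReal_re]
      rw [Finset.sum_const, nsmul_eq_mul]
    rw [← hsum] at hG
    push_cast at hswge
    have hG0 : (0 : ℝ) ≤ m * k ^ 2 / 2 ^ ξ := by positivity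
    set g := ∑ x : Fin k → Bits n with PatchwiseInjective hn x, (A x x).re
    have h3 : s * (1 - m * (k : ℝ) ^ 2 / 2 ^ ξ) ≤ s * g := mul_le_mul_of_nonneg_left hG hs0
    have h4 := mul_le_mul_of_nonneg_right hs1 hG0
    refine key.trans ?_
    linarith
  · intro x hx y hy
    rcases hdich x (Finset.mem_filter.mp hx).2 y with ⟨σ, rfl⟩ | h
    · refine absurd ?_ hy
      exact Finset.mem_filter.mpr ⟨Finset.mem_univ _, fun a =>
        ((Finset.mem_filter.mp hx).2 a).comp σ.injective⟩
    · exact h.1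
  · intro x hx y
    have hx' := (Finset.mem_filter.mp hx).2
    rcases hdich x hx' y with ⟨σ, rfl⟩ | h
    · rw [haarTwirl_eq, stateMoment_apply_comp_perm, stateMoment_apply_comp_perm,
        phaseMoment_diag, ← haarTwirl_eq, hcH x (hx'.injective (by omega)), ← Complex.ofReal_mul,
        mul_assoc, ← mul_pow, mul_one_div_cancel (by positivity), one_pow, mul_one]
    · rw [← hA, h.1, h.2, mul_zero]

end

theorem mainTheorem2
    (n k ξ m : ℕ) (hξ : 1 ≤ ξ) (hm : 2 ≤ m) (hn : n = m * ξ) (b : Boundary)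
    {Ω : Type*} [MeasurableSpace Ω] (μ : Measure Ω) [IsProbabilityMeasure μ]
    (f : Block b m → Ω → Bits (ξ + ξ) → Bool)
    (hf_meas : ∀ p, Measurable (f p))
    (hf_indep : iIndepFun f μ)
    (hf_wise : ∀ p, IsTWiseIndependent (2 * k) μ (f p)) :
    IsApproxStateDesign k μ (fun ω => blockedPhaseState hn b fun p => f p ω)
        (3 * n * k ^ 2 / (2 ^ ξ * ξ) + 2 * k ^ 2 / 2 ^ n) ∧
      (3 * n * k ^ 2 / (2 ^ ξ * ξ) + 2 * k ^ 2 / 2 ^ n : ℝ) ≤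
        4 * (n * k ^ 2 / (2 ^ ξ * ξ)) := by
  have hξ' : (ξ : ℝ) ≠ 0 := by positivity
  have hm' : (2 : ℝ) ≤ m := by exact_mod_cast hm
  have hk0 : (0 : ℝ) ≤ (k : ℝ) ^ 2 := by positivity
  have e1 : (n * k ^ 2 / (2 ^ ξ * ξ) : ℝ) = m * k ^ 2 / 2 ^ ξ := by
    rw [hn]
    push_cast
    field_simp
  have e3 : (3 * n * k ^ 2 / (2 ^ ξ * ξ) : ℝ) = 3 * (m * k ^ 2 / 2 ^ ξ) := by
    rw [← e1]
    ring
  have hle : (2 : ℝ) * (k ^ 2 / 2 ^ n) ≤ m * k ^ 2 / 2 ^ ξ := by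
    rw [mul_div_assoc]
    have h : (2 : ℝ) ^ ξ ≤ 2 ^ n := pow_le_pow_right₀ one_le_two (by rw [hn]; nlinarith)
    gcongr
  rw [e1, e3, mul_div_assoc 2]
  refine ⟨fun φ hφ => ?_, by linarith⟩
  by_cases hk : 2 * k ≤ 2 ^ (ξ + ξ)
  · refine (traceNorm_phaseMoment_sub_haarTwirl_le hm hn b μ f hf_meas hf_indep hf_wise hk φ
      hφ).trans ?_
    have h : (k : ℝ) ^ 2 * (2 / (2 ^ n + 1)) ≤ 2 * (k ^ 2 / 2 ^ n) := by
      rw [mul_div_left_comm]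
      gcongr
      linarith
    linarith
  · refine (traceNorm_sub_le_two (phaseMoment_posSemidef (μ := μ) hn b hf_meas) (haarTwirl_posSemidef φ)
      (phaseMoment_trace (μ := μ) hn b hf_meas) (haarTwirl_trace φ hφ)).trans ?_
    have h1 : ((2 : ℝ) ^ ξ) * 2 ^ ξ ≤ 2 * k := by
      rw [← pow_add]
      exact_mod_cast (not_le.mp hk).le
    have h2 : (2 : ℝ) ≤ 2 ^ ξ := by
      simpa using pow_le_pow_right₀ (one_le_two (α := ℝ)) hξ
    have h3 : (1 : ℝ) ≤ m * k ^ 2 / 2 ^ ξ := by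
      have hkt : (2 : ℝ) ^ ξ ≤ k := by nlinarith
      rw [le_div_iff₀ (by positivity), one_mul]
      calc (2 : ℝ) ^ ξ ≤ 1 * (k * 1) := by linarith
        _ ≤ m * (k * k) := by gcongr <;> linarith
        _ = m * k ^ 2 := by ring
    have h4 : (0 : ℝ) ≤ k ^ 2 / 2 ^ n := by positivity
    linarith
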